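/- There is an absolute constant $\gamma>0$ (one may take $\gamma=\tfrac14 e^{-1/2}\approx 0.1516$, in particular $\gamma=0.151$) with the following property. Let $n,m\ge 0$ and $r\ge 1$ be integers and let $q_1,\dots,q_m:\mathbb{R}^n\to\mathbb{R}$ be quadratic forms such that each $q_k$ depends on at most $r$ of the variables $x_1,\dots,x_n$ and, for each $k$, there are at most $r$ indices $j\neq k$ such that $q_k$ and $q_j$ have a common variable (a variable on which both depend). Suppose that $|q_k(x)|\le \|x\|^2/r$ for all $x\in\mathbb{R}^n$ and all $k=1,\dots,m$, where $\|\cdot\|$ is the Euclidean norm. Then $$\frac{1}{(2\pi)^{n/2}}\int_{\mathbb{R}^n}\bigl(1+\omega q_1(x)\bigr)\cdots\bigl(1+\omega q_m(x)\bigr)\,e^{-\|x\|^2/2}\,dx\ \neq\ 0$$ for all $\omega\in\mathbb{C}$ with $|\omega|\le\gamma$. -/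

import Mathlib

open MeasureTheory

noncomputable section

/-- The set of (indices of) variables on which a quadratic form on `ℝⁿ` depends: the `i`-th
variable belongs to it iff changing the `i`-th coordinate alone can change the value of the form. -/
def quadFormVars {n : ℕ} (q : QuadraticForm ℝ (EuclideanSpace ℝ (Fin n))) : Set (Fin n) :=
  {i | ∃ x y : EuclideanSpace ℝ (Fin n), (∀ j, j ≠ i → x j = y j) ∧ q x ≠ q y}

/-- The average of `∏ₖ (1 + ω qₖ(x))` with respect to the standard Gaussian measure on `ℝⁿ`. -/
def gaussianAverage {n m : ℕ} (q : Fin m → QuadraticForm ℝ (EuclideanSpace ℝ (Fin n)))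
    (ω : ℂ) : ℂ :=
  ((1 / (2 * Real.pi) ^ ((n : ℝ) / 2) : ℝ) : ℂ) *
    ∫ x : EuclideanSpace ℝ (Fin n),
      (∏ k : Fin m, (1 + ω * ((q k x : ℝ) : ℂ))) * ((Real.exp (-‖x‖ ^ 2 / 2) : ℝ) : ℂ)

end

/-! Write `q k x = ⟪Q k x, x⟫` with `Q k` symmetric, and let `F S` be the Gaussian integral of the
product over `S`. Adding one factor changes `F S` by `ω` times an integral with `⟪Q k x, x⟫`
inserted, so it suffices to bound inserted integrals by `|F S|`. Integration by parts
(`insertedIntegral_eq`) turns an inserted `A` into `tr A * F S` plus terms over `j ∈ S` with `Q j ∘L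
A` inserted and factor `j` removed. If `A` outputs only into the variables of form `k`, then the
trace is at most `r * ‖A‖` and only the at most `r` forms `j` overlapping `k` contribute. Since `‖Q
j‖ ≤ 1 / r`, the bound `2 * r * ‖A‖ * |F S|` and the ratio bound `s * |F S| ≤ |F (S ∪ {k})|` follow
together by induction on `S` (`formIntegral_ne_zero_and_bounds`). -/

noncomputable section

/-! ### Gaussian weight and integration by parts -/

section Gaussian

variable {E : Type*} [NormedAddCommGroup E]

/-- The unnormalized standard Gaussian weight, as a complex number. -/
def gaussianWeight (x : E) : ℂ := ((Real.exp (-‖x‖ ^ 2 / 2) : ℝ) : ℂ)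

theorem continuous_gaussianWeight : Continuous (gaussianWeight (E := E)) := by
  unfold gaussianWeight
  fun_prop

theorem exists_pow_mul_exp_le (k : ℕ) :
    ∃ C : ℝ, ∀ t : ℝ, 0 ≤ t → (1 + t) ^ k * Real.exp (-t ^ 2 / 2) ≤ C * Real.exp (-(1/4) * t ^ 2) := by
  refine ⟨k.factorial * Real.exp 2, fun t ht => ?_⟩
  have h1 := Real.pow_div_factorial_le_exp (x := 1 + t) (by positivity) k
  rw [div_le_iff₀ (by positivity)] at h1
  calc (1 + t) ^ k * Real.exp (-t ^ 2 / 2)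
      ≤ Real.exp (1 + t) * k.factorial * Real.exp (-t ^ 2 / 2) := by gcongr
    _ = k.factorial * Real.exp (1 + t + -t ^ 2 / 2) := by rw [Real.exp_add (1 + t)]; ring
    _ ≤ k.factorial * Real.exp (2 + -(1/4) * t ^ 2) := by
        refine mul_le_mul_of_nonneg_left (Real.exp_le_exp.2 ?_) (by positivity)
        -- The gap between the exponents is `(t - 2) ^ 2 / 4`.
        nlinarith [sq_nonneg (t - 2)]
    _ = _ := by rw [Real.exp_add]; ring

variable [InnerProductSpace ℝ E]

theorem hasLineDerivAt_gaussianWeight (x v : E) :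
    HasLineDerivAt ℝ gaussianWeight (-((inner ℝ v x : ℝ) : ℂ) * gaussianWeight x) x v := by
  have h := (((hasStrictFDerivAt_norm_sq x).hasFDerivAt.neg).mul_const (1/2 : ℝ)).exp
  have h2 := (Complex.ofRealCLM.hasFDerivAt.comp x h).hasLineDerivAt v
  convert! h2 using 1
  · ext y; simp [gaussianWeight, div_eq_mul_inv]
  · simp [gaussianWeight, div_eq_mul_inv, real_inner_comm]; ring

variable [FiniteDimensional ℝ E] [MeasurableSpace E] [BorelSpace E]

theorem integrable_exp_neg_mul_norm_sq {b : ℝ} (hb : 0 < b) :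
    Integrable (fun x : E => Real.exp (-b * ‖x‖ ^ 2)) := by
  have h := (GaussianFourier.integrable_cexp_neg_mul_sq_norm_add (V := E) (b := (b : ℂ))
    (by simpa using hb) 0 0).norm
  refine h.congr (Filter.Eventually.of_forall fun x => ?_)
  simp only [Complex.norm_exp]
  congr 1
  norm_cast
  simp

/-- A function of temperate growth is integrable against the Gaussian weight. -/
theorem Function.HasTemperateGrowth.integrable_mul_gaussianWeight {f : E → ℂ}
    (hf : f.HasTemperateGrowth) : Integrable (fun x => f x * gaussianWeight x) := by
  obtain ⟨k, C, hC⟩ := hf.2 0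
  obtain ⟨C', hC'⟩ := exists_pow_mul_exp_le k
  refine ((integrable_exp_neg_mul_norm_sq (E := E) (b := 1/4) (by norm_num)).const_mul
    (|C| * C')).mono' (hf.1.continuous.mul continuous_gaussianWeight).aestronglyMeasurable
    (Filter.Eventually.of_forall fun x => ?_)
  have h1 := hC x
  rw [norm_iteratedFDeriv_zero] at h1
  have h2 : ‖gaussianWeight x‖ = Real.exp (-‖x‖ ^ 2 / 2) := by
    rw [gaussianWeight, Complex.norm_real, Real.norm_eq_abs, abs_of_pos (Real.exp_pos _)]
  rw [norm_mul, h2]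
  calc ‖f x‖ * Real.exp (-‖x‖ ^ 2 / 2)
      ≤ (|C| * (1 + ‖x‖) ^ k) * Real.exp (-‖x‖ ^ 2 / 2) := by
        gcongr
        exact h1.trans (by gcongr; exact le_abs_self C)
    _ = |C| * ((1 + ‖x‖) ^ k * Real.exp (-‖x‖ ^ 2 / 2)) := by ring
    _ ≤ |C| * (C' * Real.exp (-(1/4) * ‖x‖ ^ 2)) :=
        mul_le_mul_of_nonneg_left (hC' _ (norm_nonneg x)) (abs_nonneg C)
    _ = _ := by ring

/-- Gaussian integration by parts (Stein's lemma). -/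
theorem integral_mul_inner_mul_gaussianWeight {f f' : E → ℂ} {v : E}
    (hf : f.HasTemperateGrowth) (hf' : f'.HasTemperateGrowth)
    (h : ∀ x, HasLineDerivAt ℝ f (f' x) x v) :
    ∫ x, f x * ((inner ℝ v x : ℝ) : ℂ) * gaussianWeight x = ∫ x, f' x * gaussianWeight x := by
  have hg : (fun x => f x * ((inner ℝ v x : ℝ) : ℂ)).HasTemperateGrowth :=
    hf.mul (by fun_prop)
  have key := integral_bilinear_hasLineDerivAt_right_eq_neg_left_of_integrable
    (μ := (volume : Measure E)) (f := f) (f' := f') (g := gaussianWeight)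
    (g' := fun x => -((inner ℝ v x : ℝ) : ℂ) * gaussianWeight x) (v := v)
    (B := ContinuousLinearMap.mul ℝ ℂ)
    (by simpa using hf'.integrable_mul_gaussianWeight)
    (by simpa [mul_assoc] using hg.integrable_mul_gaussianWeight)
    (by simpa using hf.integrable_mul_gaussianWeight)
    (fun x _ => h x) (fun x _ => hasLineDerivAt_gaussianWeight x v)
  simp only [ContinuousLinearMap.mul_apply', neg_mul, mul_neg, integral_neg, neg_inj] at key
  rw [← key]
  simp only [mul_assoc]

theorem integral_gaussianWeight_ne_zero : ∫ x : E, gaussianWeight x ≠ 0 := by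
  have h := GaussianFourier.integral_rexp_neg_mul_sq_norm (V := E) (b := 1/2) (by norm_num)
  have h2 : ∫ x : E, gaussianWeight x = ((∫ x : E, Real.exp (-(1/2) * ‖x‖ ^ 2) : ℝ) : ℂ) := by
    rw [← integral_complex_ofReal]
    congr 1; ext x; simp only [gaussianWeight]; congr 2; ring
  rw [h2, h]
  norm_cast
  positivity

end Gaussian

/-! ### Products of quadratic factors and the recursion for their integrals -/

section Forms

variable {E : Type*} [NormedAddCommGroup E] [InnerProductSpace ℝ E]
  {ι : Type*} (Q : ι → E →L[ℝ] E) (ω : ℂ)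

/-- The product `∏ k ∈ S, (1 + ω ⟪Q k x, x⟫)`. -/
def formProd (S : Finset ι) (x : E) : ℂ := ∏ k ∈ S, (1 + ω * ((inner ℝ (Q k x) x : ℝ) : ℂ))

theorem hasTemperateGrowth_inner_clm (A B : E →L[ℝ] E) :
    (fun x => ((inner ℝ (A x) (B x) : ℝ) : ℂ)).HasTemperateGrowth := by
  have h : (fun x => inner ℝ (A x) (B x)).HasTemperateGrowth :=
    (innerSL ℝ (E := E)).bilinear_hasTemperateGrowth A.hasTemperateGrowth B.hasTemperateGrowth
  exact Function.Complex.hasTemperateGrowth_ofReal.comp h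

theorem hasTemperateGrowth_formProd (S : Finset ι) : (formProd Q ω S).HasTemperateGrowth := by
  classical
  induction S using Finset.induction_on with
  | empty => exact Function.HasTemperateGrowth.const (1 : ℂ)
  | insert a S ha ih =>
    have : formProd Q ω (insert a S) = fun x =>
        (1 + ω * ((inner ℝ (Q a x) x : ℝ) : ℂ)) * formProd Q ω S x := by
      ext x; simp [formProd, ha]
    rw [this]
    have h := hasTemperateGrowth_inner_clm (Q a) (.id ℝ E)
    simp only [ContinuousLinearMap.id_apply] at h
    fun_prop

variable {Q}

theorem hasDerivAt_inner_clm_line {A : E →L[ℝ] E} (hA : ∀ x y, inner ℝ (A x) y = inner ℝ x (A y))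
    (x v : E) :
    HasDerivAt (fun t : ℝ => inner ℝ (A (x + t • v)) (x + t • v)) (2 * inner ℝ (A x) v) 0 := by
  have h : HasDerivAt (fun t : ℝ => x + t • v) v 0 := by
    simpa using ((hasDerivAt_id (0 : ℝ)).smul_const v).const_add x
  have h2 := (A.hasFDerivAt (x := x + (0 : ℝ) • v)).comp_hasDerivAt (0 : ℝ) h
  convert! h2.inner ℝ h using 1
  simp only [Function.comp, zero_smul, add_zero]
  rw [hA v x, real_inner_comm v, two_mul]

theorem hasLineDerivAt_formProd [DecidableEq ι]
    (hQ : ∀ k x y, inner ℝ (Q k x) y = inner ℝ x (Q k y)) (S : Finset ι) (x v : E) :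
    HasLineDerivAt ℝ (formProd Q ω S)
      (∑ j ∈ S, 2 * ω * ((inner ℝ (Q j x) v : ℝ) : ℂ) * formProd Q ω (S.erase j) x) x v := by
  have h := HasDerivAt.fun_finsetProd (u := S) (x := (0 : ℝ))
    (f := fun k (t : ℝ) => 1 + ω * ((inner ℝ (Q k (x + t • v)) (x + t • v) : ℝ) : ℂ))
    (f' := fun k => ω * ((2 * inner ℝ (Q k x) v : ℝ) : ℂ))
    (fun k _ => ((hasDerivAt_inner_clm_line (hQ k) x v).ofReal_comp.const_mul ω).const_add 1)
  unfold HasLineDerivAt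
  convert! h using 1
  refine Finset.sum_congr rfl fun j _ => ?_
  simp [formProd]
  ring

variable [FiniteDimensional ℝ E] [MeasurableSpace E] [BorelSpace E]

variable (Q) in
/-- The Gaussian integral of `formProd Q ω S`. -/
def formIntegral (S : Finset ι) : ℂ := ∫ x, formProd Q ω S x * gaussianWeight x

variable (Q) in
/-- The Gaussian integral of `⟪A x, x⟫ * formProd Q ω S x`. -/
def insertedIntegral (S : Finset ι) (A : E →L[ℝ] E) : ℂ :=
  ∫ x, ((inner ℝ (A x) x : ℝ) : ℂ) * formProd Q ω S x * gaussianWeight x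

/-- Expand `⟪A x, x⟫ = ∑ i, ⟪A x, b i⟫ ⟪b i, x⟫` and apply Stein's lemma in each direction `b i`.
Differentiating `⟪A x, b i⟫` yields the trace; differentiating factor `j` yields `⟪A x, Q j x⟫`. `A`
must be allowed to be non-symmetric, since `Q j ∘L A` need not be symmetric. -/
theorem insertedIntegral_eq [DecidableEq ι]
    (hQ : ∀ k x y, inner ℝ (Q k x) y = inner ℝ x (Q k y)) (S : Finset ι) (A : E →L[ℝ] E)
    {κ : Type*} [Fintype κ] (b : OrthonormalBasis κ ℝ E) :
    insertedIntegral Q ω S A = ((∑ i, inner ℝ (b i) (A (b i)) : ℝ) : ℂ) * formIntegral Q ω S +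
      ∑ j ∈ S, 2 * ω * insertedIntegral Q ω (S.erase j) (Q j ∘L A) := by
  have tF := hasTemperateGrowth_formProd Q ω
  have tI : ∀ (B : E →L[ℝ] E) (v : E),
      (fun x => ((inner ℝ (B x) v : ℝ) : ℂ)).HasTemperateGrowth := fun B v =>
    Function.Complex.hasTemperateGrowth_ofReal.comp
      ((Function.hasTemperateGrowth_inner_left v).comp B.hasTemperateGrowth)
  have tI' : ∀ (B : E →L[ℝ] E),
      (fun x => ((inner ℝ (B x) x : ℝ) : ℂ)).HasTemperateGrowth := fun B =>
    hasTemperateGrowth_inner_clm B (.id ℝ E)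
  let G' : κ → E → ℂ := fun i x => ((inner ℝ (A (b i)) (b i) : ℝ) : ℂ) * formProd Q ω S x +
    ((inner ℝ (A x) (b i) : ℝ) : ℂ) * ∑ j ∈ S, 2 * ω * ((inner ℝ (Q j x) (b i) : ℝ) : ℂ) *
      formProd Q ω (S.erase j) x
  have tG' : ∀ i, (G' i).HasTemperateGrowth := fun i => by
    refine ((Function.HasTemperateGrowth.const _).mul (tF S)).add ((tI _ _).mul ?_)
    refine Function.HasTemperateGrowth.sum fun j _ => ?_
    exact ((Function.HasTemperateGrowth.const _).mul (tI _ _)).mul (tF _)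
  have stein : ∀ i, ∫ x, ((inner ℝ (A x) (b i) : ℝ) : ℂ) * formProd Q ω S x *
      ((inner ℝ (b i) x : ℝ) : ℂ) * gaussianWeight x = ∫ x, G' i x * gaussianWeight x := by
    intro i
    refine integral_mul_inner_mul_gaussianWeight ((tI _ _).mul (tF S)) (tG' i) fun x => ?_
    have h1 : HasDerivAt (fun t : ℝ => ((inner ℝ (A (x + t • b i)) (b i) : ℝ) : ℂ))
        ((inner ℝ (A (b i)) (b i) : ℝ) : ℂ) 0 := by
      have : HasDerivAt (fun t : ℝ => inner ℝ (A x) (b i) + t * inner ℝ (A (b i)) (b i))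
          (inner ℝ (A (b i)) (b i)) 0 := by
        simpa using ((hasDerivAt_id (0 : ℝ)).mul_const (inner ℝ (A (b i)) (b i))).const_add
          (inner ℝ (A x) (b i))
      convert! this.ofReal_comp using 3
      simp [inner_add_left, inner_smul_left]
    have h2 := hasLineDerivAt_formProd ω hQ S x (b i)
    unfold HasLineDerivAt at h2 ⊢
    convert! h1.mul h2 using 1
    simp [G']
  have expand : ∀ x, ((inner ℝ (A x) x : ℝ) : ℂ) * formProd Q ω S x * gaussianWeight x =
      ∑ i, ((inner ℝ (A x) (b i) : ℝ) : ℂ) * formProd Q ω S x *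
        ((inner ℝ (b i) x : ℝ) : ℂ) * gaussianWeight x := by
    intro x
    rw [← b.sum_inner_mul_inner (A x) x, Complex.ofReal_sum, Finset.sum_mul, Finset.sum_mul]
    refine Finset.sum_congr rfl fun i _ => ?_
    push_cast; ring
  have collect : ∀ x, ∑ i, G' i x * gaussianWeight x =
      ((∑ i, inner ℝ (b i) (A (b i)) : ℝ) : ℂ) * (formProd Q ω S x * gaussianWeight x) +
      ∑ j ∈ S, 2 * ω * (((inner ℝ ((Q j ∘L A) x) x : ℝ) : ℂ) * formProd Q ω (S.erase j) x *
        gaussianWeight x) := by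
    intro x
    simp only [G', add_mul, Finset.sum_add_distrib, Finset.mul_sum, Finset.sum_mul]
    congr 1
    · rw [Complex.ofReal_sum, Finset.sum_mul]
      refine Finset.sum_congr rfl fun i _ => ?_
      rw [real_inner_comm]; ring
    · rw [Finset.sum_comm]
      refine Finset.sum_congr rfl fun j _ => ?_
      rw [ContinuousLinearMap.comp_apply, hQ, ← b.sum_inner_mul_inner (A x) (Q j x),
        Complex.ofReal_sum, Finset.sum_mul, Finset.sum_mul, Finset.mul_sum]
      refine Finset.sum_congr rfl fun i _ => ?_
      rw [real_inner_comm (b i) (Q j x)]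
      push_cast; ring
  have int1 : ∀ i, Integrable (fun x => G' i x * gaussianWeight x) := fun i =>
    (tG' i).integrable_mul_gaussianWeight
  have int0 : ∀ i, Integrable (fun x => ((inner ℝ (A x) (b i) : ℝ) : ℂ) * formProd Q ω S x *
        ((inner ℝ (b i) x : ℝ) : ℂ) * gaussianWeight x) := fun i =>
    (((tI A (b i)).mul (tF S)).mul (Function.Complex.hasTemperateGrowth_ofReal.comp
      (Function.hasTemperateGrowth_inner_right (b i)))).integrable_mul_gaussianWeight
  have int2 : ∀ (T : Finset ι) (B : E →L[ℝ] E), Integrable (fun x =>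
      ((inner ℝ (B x) x : ℝ) : ℂ) * formProd Q ω T x * gaussianWeight x) := fun T B =>
    ((tI' B).mul (tF T)).integrable_mul_gaussianWeight
  rw [insertedIntegral]
  simp_rw [expand]
  rw [integral_finsetSum _ fun i _ => int0 i]
  simp_rw [stein]
  rw [← integral_finsetSum _ fun i _ => int1 i]
  simp_rw [collect]
  rw [integral_add ((tF S).integrable_mul_gaussianWeight.const_mul _)
    (integrable_finsetSum _ fun j _ => (int2 _ _).const_mul _),
    integral_finsetSum _ fun j _ => (int2 _ _).const_mul _]
  simp_rw [integral_const_mul]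
  rfl

theorem formIntegral_insert [DecidableEq ι] {S : Finset ι} {k : ι} (hk : k ∉ S) :
    formIntegral Q ω (insert k S) =
      formIntegral Q ω S + ω * insertedIntegral Q ω S (Q k) := by
  have h : Integrable fun x => ((inner ℝ (Q k x) x : ℝ) : ℂ) * formProd Q ω S x * gaussianWeight x :=
    ((hasTemperateGrowth_inner_clm (Q k) (.id ℝ E)).mul
      (hasTemperateGrowth_formProd Q ω S)).integrable_mul_gaussianWeight
  rw [formIntegral, formIntegral, insertedIntegral, ← integral_const_mul, ← integral_add
    (hasTemperateGrowth_formProd Q ω S).integrable_mul_gaussianWeight (h.const_mul ω)]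
  congr 1; ext x
  simp [formProd, hk]
  ring

end Forms

/-! ### The induction on partial products -/

section Bounds

variable {n r : ℕ} {ι : Type*} [Finite ι] [DecidableEq ι]
  {Q : ι → EuclideanSpace ℝ (Fin n) →L[ℝ] EuclideanSpace ℝ (Fin n)} {ω : ℂ}

theorem abs_trace_le_of_apply_eq_zero {A : EuclideanSpace ℝ (Fin n) →L[ℝ] EuclideanSpace ℝ (Fin n)}
    {V : Set (Fin n)} (hA : ∀ x, ∀ i ∉ V, A x i = 0) :
    |∑ i, inner ℝ (EuclideanSpace.basisFun (Fin n) ℝ i) (A (EuclideanSpace.basisFun (Fin n) ℝ i))|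
      ≤ V.ncard * ‖A‖ := by
  classical
  set e := EuclideanSpace.basisFun (Fin n) ℝ
  have h0 : ∑ i, inner ℝ (e i) (A (e i)) = ∑ i ∈ V.toFinset, inner ℝ (e i) (A (e i)) := by
    refine (Finset.sum_subset (Finset.subset_univ _) fun i _ hi => ?_).symm
    rw [EuclideanSpace.basisFun_inner]
    exact hA (e i) i (by simpa using hi)
  rw [h0, Set.ncard_eq_toFinset_card']
  refine (Finset.abs_sum_le_sum_abs _ _).trans ?_
  rw [← nsmul_eq_mul]
  refine Finset.sum_le_card_nsmul _ _ _ fun i _ => ?_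
  refine (abs_real_inner_le_norm _ _).trans ?_
  simpa using A.le_opNorm (e i)

/-- If symmetric operators `Q k` of norm at most `1 / r` live on coordinate sets `V k` of size at
most `r`, each of which meets at most `r` others, then the Gaussian integrals of the partial
products do not vanish, and control the integrals with one inserted operator. -/
theorem formIntegral_ne_zero_and_bounds (hr : 1 ≤ r) {V : ι → Set (Fin n)} {s : ℝ} (hs : 0 < s)
    (hs' : s ≤ 2 / 3) (hω : ‖ω‖ ≤ s / 4)
    (hQ : ∀ k x y, inner ℝ (Q k x) y = inner ℝ x (Q k y)) (hnorm : ∀ k, ‖Q k‖ ≤ 1 / r)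
    (hout : ∀ k x, ∀ i ∉ V k, Q k x i = 0)
    (hin : ∀ k x, (∀ i ∈ V k, x i = 0) → Q k x = 0)
    (hV : ∀ k, (V k).ncard ≤ r)
    (hdeg : ∀ k, {j | j ≠ k ∧ (V k ∩ V j).Nonempty}.ncard ≤ r)
    (S : Finset ι) :
    formIntegral Q ω S ≠ 0 ∧ ∀ k ∉ S,
      (∀ A : EuclideanSpace ℝ (Fin n) →L[ℝ] EuclideanSpace ℝ (Fin n),
        (∀ x, ∀ i ∉ V k, A x i = 0) →
        ‖insertedIntegral Q ω S A‖ ≤ 2 * r * ‖A‖ * ‖formIntegral Q ω S‖) ∧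
      s * ‖formIntegral Q ω S‖ ≤ ‖formIntegral Q ω (insert k S)‖ := by
  classical
  have hr0 : (0 : ℝ) < r := by exact_mod_cast hr
  induction S using Finset.strongInduction with
  | H S ih =>
  -- The ratio bound for `S.erase a` passes nonvanishing up to `S`.
  have hne : formIntegral Q ω S ≠ 0 := by
    obtain rfl | ⟨a, ha⟩ := S.eq_empty_or_nonempty
    · simpa [formIntegral, formProd] using integral_gaussianWeight_ne_zero
    · obtain ⟨h1, h2⟩ := ih _ (Finset.erase_ssubset ha)
      have h3 := (h2 a (Finset.notMem_erase a S)).2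
      rw [Finset.insert_erase ha] at h3
      exact norm_pos_iff.1 (lt_of_lt_of_le (mul_pos hs (norm_pos_iff.2 h1)) h3)
  have hbound : ∀ k ∉ S, ∀ A : EuclideanSpace ℝ (Fin n) →L[ℝ] EuclideanSpace ℝ (Fin n),
      (∀ x, ∀ i ∉ V k, A x i = 0) →
      ‖insertedIntegral Q ω S A‖ ≤ 2 * r * ‖A‖ * ‖formIntegral Q ω S‖ := by
    intro k hk A hA
    rw [insertedIntegral_eq ω hQ S A (EuclideanSpace.basisFun (Fin n) ℝ)]
    set N : Finset ι := {j ∈ S | (V k ∩ V j).Nonempty}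
    have hNcard : (N.card : ℝ) ≤ r := by
      rw [← Set.ncard_coe_finset]
      refine Nat.cast_le.2 (le_trans (Set.ncard_le_ncard fun j hj => ?_) (hdeg k))
      obtain ⟨hjS, hj⟩ := Finset.mem_filter.1 (Finset.mem_coe.1 hj)
      exact ⟨fun h => hk (h ▸ hjS), hj⟩
    have hsum : ∑ j ∈ S, 2 * ω * insertedIntegral Q ω (S.erase j) (Q j ∘L A) =
        ∑ j ∈ N, 2 * ω * insertedIntegral Q ω (S.erase j) (Q j ∘L A) := by
      refine (Finset.sum_subset (Finset.filter_subset _ _) fun j hj hjN => ?_).symm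
      have hdisj : ∀ i ∈ V j, i ∉ V k := fun i hi hi' =>
        hjN (Finset.mem_filter.2 ⟨hj, i, hi', hi⟩)
      have : Q j ∘L A = 0 := by
        ext1 x
        exact hin j _ fun i hi => hA x i (hdisj i hi)
      simp [this, insertedIntegral]
    have hterm : ∀ j ∈ N, ‖2 * ω * insertedIntegral Q ω (S.erase j) (Q j ∘L A)‖ ≤
        ‖A‖ * ‖formIntegral Q ω S‖ := by
      intro j hj
      have hjS := (Finset.mem_filter.1 hj).1
      obtain ⟨h1, h2⟩ := ((ih _ (Finset.erase_ssubset hjS)).2 j (Finset.notMem_erase j S))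
      rw [Finset.insert_erase hjS] at h2
      -- `Q j ∘L A` outputs into `V j` and `j ∉ S.erase j`, so the induction hypothesis applies with
      -- `j` in the role of `k`.
      have h3 := h1 (Q j ∘L A) fun x i hi => hout j _ i hi
      have h4 : ‖Q j ∘L A‖ ≤ 1 / r * ‖A‖ :=
        (ContinuousLinearMap.opNorm_comp_le _ _).trans (by gcongr; exact hnorm j)
      rw [norm_mul, norm_mul, Complex.norm_two]
      calc 2 * ‖ω‖ * ‖insertedIntegral Q ω (S.erase j) (Q j ∘L A)‖
          ≤ 2 * (s / 4) * (2 * r * (1 / r * ‖A‖) * ‖formIntegral Q ω (S.erase j)‖) := by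
            gcongr
            exact h3.trans (by gcongr)
        _ = ‖A‖ * (s * ‖formIntegral Q ω (S.erase j)‖) := by field_simp; ring
        _ ≤ _ := by gcongr
    rw [hsum]
    have htr := abs_trace_le_of_apply_eq_zero hA
    calc _ ≤ r * ‖A‖ * ‖formIntegral Q ω S‖ + r * (‖A‖ * ‖formIntegral Q ω S‖) := by
          refine (norm_add_le _ _).trans (add_le_add ?_ ?_)
          · rw [norm_mul, Complex.norm_real, Real.norm_eq_abs]
            gcongr
            refine htr.trans ?_
            gcongr
            exact hV k
          · refine (norm_sum_le_of_le _ hterm).trans ?_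
            rw [Finset.sum_const, nsmul_eq_mul]
            gcongr
      _ = _ := by ring
  refine ⟨hne, fun k hk => ⟨hbound k hk, ?_⟩⟩
  rw [formIntegral_insert ω hk]
  have h1 := hbound k hk (Q k) (hout k)
  have h2 : ‖ω * insertedIntegral Q ω S (Q k)‖ ≤ s / 2 * ‖formIntegral Q ω S‖ := by
    rw [norm_mul]
    calc ‖ω‖ * ‖insertedIntegral Q ω S (Q k)‖
        ≤ s / 4 * (2 * r * (1 / r) * ‖formIntegral Q ω S‖) := by
          gcongr
          exact h1.trans (by gcongr; exact hnorm k)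
      _ = _ := by field_simp; ring
  have h3 := norm_sub_le_norm_add (formIntegral Q ω S) (ω * insertedIntegral Q ω S (Q k))
  -- The loss is at most `s / 2`, and `1 - s / 2 ≥ s` is exactly `s ≤ 2 / 3`.
  nlinarith [norm_nonneg (formIntegral Q ω S)]

end Bounds

/-! ### From quadratic forms to symmetric operators -/

section QuadraticForms

variable {n : ℕ}

/-- The self-adjoint operator representing a quadratic form. -/
theorem exists_symmetric_clm_of_quadraticForm {E : Type*} [NormedAddCommGroup E]
    [InnerProductSpace ℝ E] [FiniteDimensional ℝ E] (q : QuadraticForm ℝ E) :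
    ∃ A : E →L[ℝ] E, (∀ x y, inner ℝ (A x) y = inner ℝ x (A y)) ∧
      (∀ x, inner ℝ (A x) x = q x) ∧
      ∀ x y, 2 * inner ℝ (A x) y = q (x + y) - q x - q y := by
  let B := QuadraticMap.associated (R := ℝ) q
  let A : E →ₗ[ℝ] E := (InnerProductSpace.toDual ℝ E).symm.toLinearEquiv.toLinearMap ∘ₗ
    LinearMap.toContinuousLinearMap.toLinearMap ∘ₗ B
  have hA : ∀ x y, inner ℝ (A x) y = B x y := fun x y => by
    simp [A, InnerProductSpace.toDual_symm_apply]
  have hsymm : ∀ x y, B x y = B y x := fun x y => QuadraticMap.associated_isSymm ℝ q x y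
  refine ⟨LinearMap.toContinuousLinearMap A, fun x y => ?_, fun x => ?_, fun x y => ?_⟩
  · simp only [LinearMap.coe_toContinuousLinearMap']
    rw [hA, ← real_inner_comm, hA, hsymm]
  · simp only [LinearMap.coe_toContinuousLinearMap']
    rw [hA]
    exact QuadraticMap.associated_eq_self_apply ℝ q x
  · simp only [LinearMap.coe_toContinuousLinearMap']
    have h : 2 • B x y = q (x + y) - q x - q y :=
      LinearMap.congr_fun₂ (QuadraticMap.two_nsmul_associated ℝ q) x y
    rwa [hA, ← Nat.cast_ofNat, ← nsmul_eq_mul]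

/-- Polarization and the parallelogram law: for unit vectors, `4 * ⟪A x, y⟫ ≤ c * (‖x + y‖ ^ 2 + ‖x
- y‖ ^ 2) = 4 * c`. -/
theorem opNorm_le_of_abs_quadraticForm_le {E : Type*} [NormedAddCommGroup E]
    [InnerProductSpace ℝ E] {A : E →L[ℝ] E} (hA : ∀ x y, inner ℝ (A x) y = inner ℝ x (A y))
    {c : ℝ} (hc : 0 ≤ c) (h : ∀ x, |inner ℝ (A x) x| ≤ c * ‖x‖ ^ 2) : ‖A‖ ≤ c := by
  refine A.opNorm_le_of_re_inner_le hc fun x y hx hy => ?_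
  have h1 := (abs_le.1 (h (x + y))).2
  have h2 := (abs_le.1 (h (x - y))).1
  have h3 := parallelogram_law_with_norm ℝ x y
  have h4 : inner ℝ (A (x + y)) (x + y) - inner ℝ (A (x - y)) (x - y) = 4 * inner ℝ (A x) y := by
    simp only [map_add, map_sub, inner_add_left, inner_add_right, inner_sub_left, inner_sub_right]
    rw [hA y x, real_inner_comm (A x) y]
    ring
  rw [hx, hy] at h3
  simp only [RCLike.re_to_real]
  nlinarith

theorem quadForm_add_single {q : QuadraticForm ℝ (EuclideanSpace ℝ (Fin n))} {i : Fin n}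
    (hi : i ∉ quadFormVars q) (x : EuclideanSpace ℝ (Fin n)) (t : ℝ) :
    q (x + EuclideanSpace.single i t) = q x := by
  by_contra hne
  refine hi ⟨_, _, fun j hj => ?_, hne⟩
  simp [hj]

/-- A quadratic form on Euclidean space bounded by `c * ‖x‖ ^ 2` is represented by a symmetric
operator of norm at most `c`, which acts on the variables of the form only. -/
theorem exists_clm_of_abs_quadraticForm_le {q : QuadraticForm ℝ (EuclideanSpace ℝ (Fin n))} {c : ℝ}
    (hc : 0 ≤ c) (hq : ∀ x, |q x| ≤ c * ‖x‖ ^ 2) :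
    ∃ A : EuclideanSpace ℝ (Fin n) →L[ℝ] EuclideanSpace ℝ (Fin n),
      (∀ x y, inner ℝ (A x) y = inner ℝ x (A y)) ∧ (∀ x, inner ℝ (A x) x = q x) ∧ ‖A‖ ≤ c ∧
      (∀ x, ∀ i ∉ quadFormVars q, A x i = 0) ∧
      ∀ x, (∀ i ∈ quadFormVars q, x i = 0) → A x = 0 := by
  obtain ⟨A, hsymm, hval, hpolar⟩ := exists_symmetric_clm_of_quadraticForm q
  have hout : ∀ x, ∀ i ∉ quadFormVars q, A x i = 0 := by
    intro x i hi
    have h1 := hpolar x (EuclideanSpace.single i 1)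
    have h2 := quadForm_add_single hi 0 1
    rw [zero_add, map_zero] at h2
    rw [quadForm_add_single hi x 1, h2, EuclideanSpace.inner_single_right] at h1
    simpa using h1
  refine ⟨A, hsymm, hval, opNorm_le_of_abs_quadraticForm_le hsymm hc fun x => ?_, hout,
    fun x hx => ?_⟩
  · rw [hval]
    exact hq x
  -- By symmetry, `⟪A x, y⟫ = ⟪x, A y⟫`, and `x` and `A y` have disjoint supports.
  · refine ext_inner_right ℝ fun y => ?_
    rw [hsymm, inner_zero_left, PiLp.inner_apply]
    refine Finset.sum_eq_zero fun i _ => ?_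
    by_cases hi : i ∈ quadFormVars q
    · simp [hx i hi]
    · simp [hout y i hi]

theorem gaussianAverage_eq {m : ℕ} (q : Fin m → QuadraticForm ℝ (EuclideanSpace ℝ (Fin n)))
    (ω : ℂ) {Q : Fin m → EuclideanSpace ℝ (Fin n) →L[ℝ] EuclideanSpace ℝ (Fin n)}
    (hQ : ∀ k x, inner ℝ (Q k x) x = q k x) :
    gaussianAverage q ω =
      ((1 / (2 * Real.pi) ^ ((n : ℝ) / 2) : ℝ) : ℂ) * formIntegral Q ω Finset.univ := by
  simp only [gaussianAverage, formIntegral, formProd, gaussianWeight, hQ]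

end QuadraticForms

/-- Lets `s = exp (-1 / 2)` meet the condition `s ≤ 2 / 3` of the induction. -/
theorem exp_neg_half_le : Real.exp (-1 / 2) ≤ 2 / 3 := by
  have h1 : Real.exp (-1 / 2) * Real.exp (1 / 2) = 1 := by rw [← Real.exp_add]; norm_num
  have h2 := Real.add_one_le_exp (1 / 2 : ℝ)
  nlinarith [Real.exp_pos (-1 / 2)]

theorem lt_exp_neg_half : 0.604 < Real.exp (-1 / 2) := by
  have h1 : Real.exp (-1 / 2) ^ 2 * Real.exp 1 = 1 := by
    rw [pow_two, ← Real.exp_add, ← Real.exp_add]; norm_num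
  have h2 := Real.exp_one_lt_d9
  by_contra! h
  have h3 : Real.exp (-1 / 2) ^ 2 ≤ 0.604 ^ 2 := by
    gcongr
  nlinarith [Real.exp_pos 1]

end

theorem theorem1p3 :
    ∃ γ : ℝ, 0 < γ ∧ 0.151 < γ ∧ γ = Real.exp (-1 / 2) / 4 ∧
      ∀ (n m r : ℕ), 1 ≤ r →
      ∀ q : Fin m → QuadraticForm ℝ (EuclideanSpace ℝ (Fin n)),
        (∀ k, (quadFormVars (q k)).ncard ≤ r) →
        (∀ k, {j : Fin m | j ≠ k ∧ (quadFormVars (q k) ∩ quadFormVars (q j)).Nonempty}.ncard ≤ r) →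
        (∀ k x, |q k x| ≤ ‖x‖ ^ 2 / (r : ℝ)) →
        ∀ ω : ℂ, ‖ω‖ ≤ γ → gaussianAverage q ω ≠ 0 := by
  refine ⟨Real.exp (-1 / 2) / 4, by positivity, by linarith [lt_exp_neg_half], rfl, ?_⟩
  intro n m r hr q hvars hdeg hq ω hω
  choose Q hsymm hval hnorm hout hin using fun k =>
    exists_clm_of_abs_quadraticForm_le (q := q k) (c := 1 / r) (by positivity)
      fun x => (hq k x).trans_eq (by ring)
  rw [gaussianAverage_eq q ω hval]
  refine mul_ne_zero ?_ (formIntegral_ne_zero_and_bounds hr (Real.exp_pos _) exp_neg_half_le hω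
    hsymm hnorm hout hin hvars hdeg Finset.univ).1
  exact Complex.ofReal_ne_zero.2 (by positivity)
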